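/- Let $(R,\mathfrak m)$ and $(S,\mathfrak n)$ be commutative noetherian local rings, and let $\varphi\colon R\to S$ be a flat local ring homomorphism such that the induced map $R/\mathfrak m\to S/\mathfrak m S$ is an isomorphism. Let $M$ be an $R$-module (not necessarily finitely generated), and let $z\geq 1$ be an integer. An $R$-module $N$ is said to satisfy NAK if $N=0$ or $N/\mathfrak m N\neq 0$. If $\operatorname{Ext}^i_R(S,M)=0$ for all $i>z$ and the $R$-module $\operatorname{Ext}^z_R(S,M)$ satisfies NAK, then $\operatorname{Ext}^z_R(S,M)=0$. -/

import Mathlib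

open CategoryTheory

universe u

/-- A module `N` over a local ring `(R, 𝔪)` *satisfies NAK* if `N = 0` or `N / 𝔪 N ≠ 0`. -/
def SatisfiesNAK (R N : Type*) [CommRing R] [IsLocalRing R] [AddCommGroup N] [Module R N] :
    Prop :=
  Subsingleton N ∨ Nontrivial (N ⧸ (IsLocalRing.maximalIdeal R • ⊤ : Submodule R N))

/-- For a local ring `(R, 𝔪)` and an `R`-algebra `S`, the ring homomorphism `R / 𝔪 → S / 𝔪 S`
induced by the structure map `R → S`. -/
def inducedResidueMap (R S : Type*) [CommRing R] [IsLocalRing R] [CommRing S] [Algebra R S] :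
    R ⧸ IsLocalRing.maximalIdeal R →+*
      S ⧸ (IsLocalRing.maximalIdeal R).map (algebraMap R S) :=
  Ideal.quotientMap ((IsLocalRing.maximalIdeal R).map (algebraMap R S)) (algebraMap R S)
    Ideal.le_comap_map

/-!
The proof replaces `S` by the cokernel `C = S / R` of the structure map. Since `R → S` is faithfully
flat, it is universally injective, so `C` is again flat; and `R / 𝔪 → S / 𝔪 S` being surjective
means `𝔪 C = C`. The long exact sequence of `0 → R → S → C → 0` shows that `Extⁱ(C, M) = 0` for
`i > z` and that `Extᶻ(C, M) → Extᶻ(S, M)` is onto, since `z ≥ 1` and `Extⁱ(R, M) = 0` for `i ≥ 1`.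
So it is enough to show `𝔪 Extᶻ(C, M) = Extᶻ(C, M)`; then `𝔪 Extᶻ(S, M) = Extᶻ(S, M)`,
and NAK finishes the proof.

Let `v = (x₁, …, xₙ)` generate `𝔪`. The Koszul complex `⋀ⁱ Rⁿ`, with differential `v ∧ -`, has
cohomology annihilated by `𝔪`, because contraction with a linear form `φ` is a null-homotopy of
multiplication by `φ v`. As `C` is flat and `𝔪 C = C`, the sequence
`0 → C ⊗ ⋀⁰ → C ⊗ ⋀¹ → ⋯ → C ⊗ ⋀ⁿ → 0` is therefore exact. Every term is a finite sum of copies of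
`C`, so its Ext into `M` vanishes above degree `z`, and shifting dimension along this *finite* exact
sequence (`ext_precomp_surjective_of_exact`) makes `Extᶻ(C ⊗ ⋀¹, M) → Extᶻ(C ⊗ ⋀⁰, M)` surjective.
The map `v ∧ -` is a combination of the maps `eⱼ ∧ -` with coefficients in `𝔪`, so that the image
lies in `𝔪 Extᶻ(C ⊗ ⋀⁰, M)`, and `C ⊗ ⋀⁰ ≅ C`.
-/

open TensorProduct

/-! ### The Koszul complex on exterior powers -/

section Koszul

variable {R : Type*} [CommRing R] {V : Type*} [AddCommGroup V] [Module R V]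

/-- The Koszul differential `⋀ⁱ V → ⋀ⁱ⁺¹ V`, `w ↦ v ∧ w`, as a linear function of `v`. -/
noncomputable def koszulDifferential (R : Type*) [CommRing R] (V : Type*) [AddCommGroup V]
    [Module R V] (i : ℕ) : V →ₗ[R] ⋀[R]^i V →ₗ[R] ⋀[R]^(i + 1) V :=
  LinearMap.mk₂ R
    (fun v w ↦ ⟨ExteriorAlgebra.ι R v * w, by
      rw [ExteriorAlgebra.exteriorPower, pow_succ']
      exact Submodule.mul_mem_mul ⟨v, rfl⟩ w.2⟩)
    (fun v v' w ↦ Subtype.ext (by simp [add_mul]))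
    (fun r v w ↦ Subtype.ext (by simp))
    (fun v w w' ↦ Subtype.ext (by simp [mul_add]))
    (fun r v w ↦ Subtype.ext (by simp))

@[simp]
lemma coe_koszulDifferential (i : ℕ) (v : V) (w : ⋀[R]^i V) :
    (koszulDifferential R V i v w : ExteriorAlgebra R V) = ExteriorAlgebra.ι R v * w := rfl

lemma koszulDifferential_comp_self (i : ℕ) (v : V) (w : ⋀[R]^i V) :
    koszulDifferential R V (i + 1) v (koszulDifferential R V i v w) = 0 :=
  Subtype.ext (by simp [← mul_assoc])

lemma contractLeft_mem_exteriorPower (φ : Module.Dual R V) (i : ℕ) {w : ExteriorAlgebra R V}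
    (hw : w ∈ ⋀[R]^(i + 1) V) : CliffordAlgebra.contractLeft φ w ∈ ⋀[R]^i V := by
  induction i generalizing w with
  | zero =>
    rw [ExteriorAlgebra.exteriorPower, zero_add, pow_one] at hw
    obtain ⟨v, rfl⟩ := hw
    rw [CliffordAlgebra.contractLeft_ι, ExteriorAlgebra.exteriorPower, pow_zero]
    exact Submodule.algebraMap_mem _
  | succ i ih =>
    rw [ExteriorAlgebra.exteriorPower, pow_succ'] at hw
    induction hw using Submodule.mul_induction_on' with
    | mem_mul_mem a ha b hb =>
      obtain ⟨v, rfl⟩ := ha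
      rw [CliffordAlgebra.contractLeft_ι_mul]
      refine sub_mem (Submodule.smul_mem _ _ hb) ?_
      rw [ExteriorAlgebra.exteriorPower, pow_succ']
      exact Submodule.mul_mem_mul ⟨v, rfl⟩ (ih hb)
    | add a _ b _ ha hb =>
      rw [map_add]
      exact add_mem ha hb

/-- Contraction with `φ` is a null-homotopy of multiplication by `φ v` on the Koszul complex of
`v`; hence `φ v` annihilates its cohomology in positive degrees. -/
lemma smul_mem_range_koszulDifferential (φ : Module.Dual R V) (v : V) (i : ℕ)
    (w : ⋀[R]^(i + 1) V) (hw : koszulDifferential R V (i + 1) v w = 0) :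
    φ v • w ∈ LinearMap.range (koszulDifferential R V i v) := by
  refine ⟨⟨CliffordAlgebra.contractLeft φ w.1, contractLeft_mem_exteriorPower φ i w.2⟩,
    Subtype.ext ?_⟩
  have h := CliffordAlgebra.contractLeft_ι_mul (Q := 0) (d := φ) v w.1
  have hw' : ExteriorAlgebra.ι R v * w.1 = 0 := congrArg Subtype.val hw
  rw [show CliffordAlgebra.ι 0 v = ExteriorAlgebra.ι R v from rfl, hw', map_zero] at h
  exact (sub_eq_zero.mp h.symm).symm

lemma smul_eq_zero_of_koszulDifferential_zero (φ : Module.Dual R V) (v : V)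
    (w : ⋀[R]^0 V) (hw : koszulDifferential R V 0 v w = 0) : φ v • w = 0 := by
  have h := CliffordAlgebra.contractLeft_ι_mul (Q := 0) (d := φ) v w.1
  have hw' : ExteriorAlgebra.ι R v * w.1 = 0 := congrArg Subtype.val hw
  obtain ⟨r, hr⟩ := Submodule.mem_one.mp
    (show w.1 ∈ (1 : Submodule R (ExteriorAlgebra R V)) from w.2)
  have h0 : CliffordAlgebra.contractLeft φ w.1 = 0 := by
    rw [← hr]
    exact CliffordAlgebra.contractLeft_algebraMap 0 φ r
  rw [show CliffordAlgebra.ι 0 v = ExteriorAlgebra.ι R v from rfl, hw', map_zero, h0, mul_zero,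
    sub_zero] at h
  exact Subtype.ext h.symm

end Koszul

/-! ### Exactness after tensoring with a flat module -/

section Flat

variable {R : Type*} [CommRing R]

/-- If the homology of `A → B → D` is annihilated by `I`, the complex becomes exact after tensoring
with a flat module `C` such that `I C = C`. -/
lemma lTensor_exact_of_smul_mem_range {A B D C : Type*} [AddCommGroup A] [Module R A]
    [AddCommGroup B] [Module R B] [AddCommGroup D] [Module R D] [AddCommGroup C] [Module R C]
    [Module.Flat R C] {I : Ideal R} (hC : I • (⊤ : Submodule R C) = ⊤)
    (f : A →ₗ[R] B) (g : B →ₗ[R] D) (hgf : g ∘ₗ f = 0)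
    (h : ∀ x ∈ I, ∀ b, g b = 0 → x • b ∈ LinearMap.range f) :
    Function.Exact (f.lTensor C) (g.lTensor C) := by
  refine LinearMap.exact_of_comp_of_mem_range ?_ fun t ht ↦ ?_
  · rw [← LinearMap.lTensor_comp, hgf, LinearMap.lTensor_zero]
  have hex := Module.Flat.lTensor_exact C (f := (LinearMap.ker g).subtype) (g := g)
    (LinearMap.exact_subtype_ker_map g)
  obtain ⟨s, rfl⟩ := (hex t).mp ht
  clear ht
  induction s with
  | zero => simp
  | add s s' hs hs' =>
    rw [map_add]
    exact add_mem hs hs'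
  | tmul c b =>
    have hc : c ∈ I • (⊤ : Submodule R C) := by rw [hC]; exact Submodule.mem_top
    rw [LinearMap.lTensor_tmul]
    induction hc using Submodule.smul_induction_on' with
    | smul x hx c _ =>
      obtain ⟨a, ha⟩ := h x hx b b.2
      refine ⟨c ⊗ₜ a, ?_⟩
      rw [LinearMap.lTensor_tmul, ha, smul_tmul]
      rfl
    | add c _ c' _ hc hc' =>
      rw [add_tmul]
      exact add_mem hc hc'

/-- The cokernel of a faithfully flat ring map is flat, because the map is universally injective. -/
lemma flat_quotient_range_of_faithfullyFlat (S : Type*) [CommRing S] [Algebra R S]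
    [Module.FaithfullyFlat R S] :
    Module.Flat R (S ⧸ LinearMap.range (Algebra.linearMap R S)) := by
  set q := (LinearMap.range (Algebra.linearMap R S)).mkQ
  have hq_surj : Function.Surjective q := Submodule.mkQ_surjective _
  have hq_exact : Function.Exact (Algebra.linearMap R S) q :=
    LinearMap.exact_map_mkQ_range _
  rw [Module.Flat.iff_lTensor_injective']
  intro I
  rw [injective_iff_map_eq_zero]
  intro t ht
  obtain ⟨s, rfl⟩ := LinearMap.rTensor_surjective I hq_surj t
  -- The image of `s` in `S ⊗ R` dies in the cokernel, so it comes from some `r : R`.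
  have h1 : q.rTensor R (I.subtype.lTensor S s) = 0 := by
    rw [← ht, ← LinearMap.comp_apply, ← LinearMap.comp_apply, LinearMap.rTensor_comp_lTensor,
      LinearMap.lTensor_comp_rTensor]
  obtain ⟨r, hr⟩ : ∃ r : R, (1 : S) ⊗ₜ[R] r = I.subtype.lTensor S s := by
    obtain ⟨r', hr'⟩ := (rTensor_exact R hq_exact hq_surj _).mp h1
    obtain ⟨r, rfl⟩ := (TensorProduct.lid R R).symm.surjective r'
    exact ⟨r, by simpa using hr'⟩
  -- The class of `r` in `R ⧸ I` vanishes, because `R ⧸ I` embeds into `S ⊗ R ⧸ I`.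
  have hrI : r ∈ I := by
    rw [← Ideal.Quotient.eq_zero_iff_mem]
    apply Module.FaithfullyFlat.tensorProduct_mk_injective (A := R) (B := S) (R ⧸ I)
    have h2 : (Submodule.mkQ I).lTensor S (I.subtype.lTensor S s) = 0 := by
      rw [← LinearMap.comp_apply, ← LinearMap.lTensor_comp,
        show (Submodule.mkQ I) ∘ₗ I.subtype = 0 from by
          ext x; exact Ideal.Quotient.eq_zero_iff_mem.mpr x.2]
      simp
    rw [← hr] at h2
    simpa using h2
  have hs : s = (1 : S) ⊗ₜ[R] (⟨r, hrI⟩ : I) := by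
    apply Module.Flat.lTensor_preserves_injective_linearMap (M := S) I.subtype
      I.subtype_injective
    rw [← hr]
    simp
  rw [hs, LinearMap.rTensor_tmul, show q 1 = 0 from (hq_exact 1).mpr ⟨1, by simp⟩, zero_tmul]

end Flat

/-! ### Vanishing and surjectivity for Ext along exact sequences -/

section Ext

variable {R : Type u} [CommRing R] {M : ModuleCat.{u} R}

open Abelian

/-- If the identity of `X` is a finite sum of endomorphisms factoring through `C`, then vanishing of
`Ext C M k` implies vanishing of `Ext X M k`. -/
lemma subsingleton_ext_of_sum_comp_eq_id {C X : ModuleCat.{u} R} {k : ℕ}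
    {ι : Type*} [Fintype ι] (p : ι → (X ⟶ C)) (s : ι → (C ⟶ X)) (h : ∑ j, p j ≫ s j = 𝟙 X)
    [Subsingleton (Ext C M k)] : Subsingleton (Ext X M k) := by
  refine subsingleton_of_forall_eq 0 fun α ↦ ?_
  rw [← Ext.mk₀_id_comp α, ← h, Ext.mk₀_sum, Ext.sum_comp]
  refine Finset.sum_eq_zero fun j _ ↦ ?_
  rw [← Ext.mk₀_comp_mk₀_assoc, Subsingleton.elim ((Ext.mk₀ (s j)).comp α (zero_add k)) 0,
    Ext.comp_zero]

lemma subsingleton_ext_tensor_finite_free (C F : Type u) [AddCommGroup C] [Module R C]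
    [AddCommGroup F] [Module R F] [Module.Finite R F] [Module.Free R F] {k : ℕ}
    [Subsingleton (Ext (ModuleCat.of R C) M k)] :
    Subsingleton (Ext (ModuleCat.of R (C ⊗[R] F)) M k) := by
  let b := Module.Free.chooseBasis R F
  refine subsingleton_ext_of_sum_comp_eq_id (C := ModuleCat.of R C)
    (fun j ↦ ModuleCat.ofHom ((TensorProduct.rid R C).toLinearMap ∘ₗ (b.coord j).lTensor C))
    (fun j ↦ ModuleCat.ofHom ((TensorProduct.mk R C F).flip (b j))) ?_
  ext : 1
  refine TensorProduct.ext' fun c w ↦ ?_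
  simp only [ModuleCat.hom_sum, ModuleCat.hom_comp, ModuleCat.hom_ofHom, ModuleCat.hom_id,
    LinearMap.sum_apply, LinearMap.comp_apply, LinearMap.lTensor_tmul, LinearEquiv.coe_coe,
    TensorProduct.rid_tmul, LinearMap.flip_apply, TensorProduct.mk_apply, LinearMap.id_apply,
    Module.Basis.coord_apply, smul_tmul]
  rw [← tmul_sum, b.sum_repr]

/-- Dimension shifting along a finite exact sequence `0 → A → E i → E (i + 1) → ⋯ → 0` whose terms
have no Ext into `M` above degree `z`. -/
lemma ext_precomp_surjective_of_exact {z : ℕ} (E : ℕ → ModuleCat.{u} R)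
    (d : ∀ i, E i ⟶ E (i + 1)) (hd : ∀ i, Function.Exact (d i) (d (i + 1)))
    (hE : ∀ i k, z < k → Subsingleton (Ext (E i) M k)) {r : ℕ} (hr : Subsingleton (E r))
    {i : ℕ} (hi : i ≤ r) {A : ModuleCat.{u} R} (f : A ⟶ E i) (hf : Function.Injective f)
    (hfd : Function.Exact f (d i)) {k : ℕ} (hk : z ≤ k) :
    Function.Surjective ((Ext.mk₀ f).precomp M (zero_add k)) := by
  induction hi using Nat.decreasingInduction generalizing A k with
  | self =>
    have hA : Limits.IsZero A :=
      @ModuleCat.isZero_of_subsingleton _ _ A hf.subsingleton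
    intro α
    refine ⟨0, ?_⟩
    rw [map_zero, ← Ext.mk₀_id_comp α, hA.eq_of_src (𝟙 A) 0, Ext.mk₀_zero, Ext.zero_comp]
  | of_succ i _ ih =>
    let B : ModuleCat.{u} R := ModuleCat.of R (LinearMap.range (d i).hom)
    let g : E i ⟶ B := ModuleCat.ofHom (d i).hom.rangeRestrict
    have hfg : Function.Exact f g := fun x ↦ by
      rw [← hfd x]
      exact Subtype.ext_iff
    have hS : (ShortComplex.mk f g
        (ModuleCat.hom_ext (LinearMap.ext fun x ↦ (hfg _).mpr ⟨x, rfl⟩))).ShortExact :=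
      ModuleCat.shortComplex_shortExact _ hfg hf (d i).hom.surjective_rangeRestrict
    -- `Ext B M (k + 1)` is a quotient of `Ext (E (i + 1)) M (k + 1) = 0`.
    have hB : Subsingleton (Ext B M (k + 1)) := by
      have := hE (i + 1) (k + 1) (by lia)
      refine (ih (A := B) (k := k + 1)
        (ModuleCat.ofHom (LinearMap.range (d i).hom).subtype) Subtype.val_injective
        (fun x ↦ ?_) (by lia)).subsingleton
      rw [hd i x]
      exact ⟨fun ⟨y, hy⟩ ↦ ⟨⟨x, y, hy⟩, rfl⟩, fun ⟨y, hy⟩ ↦ hy ▸ y.2⟩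
    intro α
    exact Ext.contravariant_sequence_exact₁ hS _ α (add_comm 1 k)
      (Subsingleton.elim (α := Ext B M (k + 1)) _ _)

lemma smul_top_ext_eq_top_of_precomp_surjective {X Y : ModuleCat.{u} R} (f : X ⟶ Y) {k : ℕ}
    (hf : Function.Surjective ((Ext.mk₀ f).precomp M (zero_add k))) {I : Ideal R}
    (h : I • (⊤ : Submodule R (Ext Y M k)) = ⊤) :
    I • (⊤ : Submodule R (Ext X M k)) = ⊤ := by
  have hrange : LinearMap.range (Ext.precompOfLinear (Ext.mk₀ f) R M (zero_add k)) = ⊤ :=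
    LinearMap.range_eq_top.mpr hf
  rw [← hrange, LinearMap.range_eq_map, ← Submodule.map_smul'', h]

/-- Let `C` be flat with `I C = C` for a finitely generated ideal `I`. If
`Ext C M k = 0` for `k > z`, then `I` times `Ext C M z` is everything: resolve `C` to the right by
the Koszul complex on generators of `I`. -/
lemma smul_top_ext_eq_top_of_flat (C : Type u) [AddCommGroup C] [Module R C] [Module.Flat R C]
    {I : Ideal R} (hI : I.FG) (hC : I • (⊤ : Submodule R C) = ⊤) {z : ℕ}
    (hz : ∀ k, z < k → Subsingleton (Ext (ModuleCat.of R C) M k)) :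
    I • (⊤ : Submodule R (Ext (ModuleCat.of R C) M z)) = ⊤ := by
  obtain ⟨n, v, hv⟩ := Submodule.fg_iff_exists_fin_generating_family.mp hI
  -- Every element of `I` is the value at `v` of a linear form, so kills the Koszul cohomology.
  have hφ : ∀ x ∈ I, ∃ φ : Module.Dual R (Fin n → R), φ v = x := fun x hx ↦ by
    rw [← hv, Submodule.mem_span_range_iff_exists_fun] at hx
    obtain ⟨c, hc⟩ := hx
    exact ⟨Fintype.linearCombination R c, by
      simpa [Fintype.linearCombination_apply, mul_comm] using hc⟩
  let D : ∀ i, (Fin n → R) →ₗ[R] _ := fun i ↦ koszulDifferential R (Fin n → R) i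
  let E : ℕ → ModuleCat.{u} R := fun i ↦ ModuleCat.of R (C ⊗[R] ⋀[R]^i (Fin n → R))
  let d : ∀ i, E i ⟶ E (i + 1) := fun i ↦ ModuleCat.ofHom ((D i v).lTensor C)
  have hd : ∀ i, Function.Exact (d i) (d (i + 1)) := fun i ↦ by
    refine lTensor_exact_of_smul_mem_range hC (D i v) (D (i + 1) v)
      (LinearMap.ext (koszulDifferential_comp_self i v)) fun x hx w hw ↦ ?_
    obtain ⟨φ, rfl⟩ := hφ x hx
    exact smul_mem_range_koszulDifferential φ v i w hw
  -- Injectivity of the first differential is exactness of `0 → E 0 → E 1`.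
  have hd0 : Function.Injective (d 0) := by
    have := lTensor_exact_of_smul_mem_range hC (0 : PUnit.{1} →ₗ[R] _) (D 0 v)
      (LinearMap.comp_zero _) fun x hx w hw ↦ by
        obtain ⟨φ, rfl⟩ := hφ x hx
        rw [smul_eq_zero_of_koszulDifferential_zero φ v w hw]
        exact zero_mem _
    rw [LinearMap.lTensor_zero] at this
    exact (LinearMap.exact_zero_iff_injective _ _).mp this
  have hE : ∀ i k, z < k → Subsingleton (Ext (E i) M k) := fun i k hk ↦
    have := hz k hk
    subsingleton_ext_tensor_finite_free C _
  have hEn : Subsingleton (E (n + 1)) := by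
    have : IsEmpty (Set.powersetCard (Fin n) (n + 1)) := ⟨fun s ↦ by
      have h := Finset.card_le_univ s.1
      rw [s.2, Fintype.card_fin] at h
      lia⟩
    have : Subsingleton (⋀[R]^(n + 1) (Fin n → R)) :=
      ((Pi.basisFun R (Fin n)).exteriorPower (n + 1)).repr.injective.subsingleton
    refine subsingleton_of_forall_eq 0 fun (t : C ⊗[R] ⋀[R]^(n + 1) (Fin n → R)) ↦ ?_
    induction t with
    | zero => rfl
    | add a b ha hb => rw [ha, hb, add_zero]
    | tmul c w => rw [Subsingleton.elim w 0, tmul_zero]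
  have hsurj : Function.Surjective ((Ext.mk₀ (d 0)).precomp M (zero_add z)) :=
    ext_precomp_surjective_of_exact E d hd hE hEn (i := 1) (by lia) (d 0) hd0 (hd 0) le_rfl
  have hvI : v ∈ I • (⊤ : Submodule R (Fin n → R)) := by
    rw [pi_eq_sum_univ' v]
    exact sum_mem fun j _ ↦ Submodule.smul_mem_smul
      (hv ▸ Submodule.subset_span ⟨j, rfl⟩) Submodule.mem_top
  have hE0 : I • (⊤ : Submodule R (Ext (E 0) M z)) = ⊤ := by
    refine eq_top_iff.mpr fun β _ ↦ ?_
    obtain ⟨α, rfl⟩ := hsurj β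
    -- `u ↦ Ext(u ∧ -)(α)` is linear, so it sends `v ∈ I Rⁿ` into `I Extᶻ(E 0, M)`.
    let Φ : (Fin n → R) →ₗ[R] Ext (E 0) M z :=
      { toFun u := (Ext.mk₀ (ModuleCat.ofHom ((D 0 u).lTensor C) : E 0 ⟶ E 1)).comp α (zero_add z)
        map_add' u u' := by
          rw [map_add, LinearMap.lTensor_add, ModuleCat.ofHom_add, Ext.mk₀_add, Ext.add_comp]
        map_smul' r u := by
          rw [map_smul, LinearMap.lTensor_smul, RingHom.id_apply, ← Ext.smul_comp, ← Ext.mk₀_smul]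
          rfl }
    have h := Submodule.mem_map_of_mem (f := Φ) hvI
    rw [Submodule.map_smul''] at h
    exact (smul_mono_right I le_top : _ ≤ I • (⊤ : Submodule R (Ext (E 0) M z))) h
  let e : E 0 ≅ ModuleCat.of R C :=
    (LinearEquiv.lTensor C (exteriorPower.zeroEquiv R (Fin n → R)) ≪≫ₗ
      TensorProduct.rid R C).toModuleIso
  refine smul_top_ext_eq_top_of_precomp_surjective e.inv (fun α ↦
    ⟨(Ext.mk₀ e.hom).comp α (zero_add z), ?_⟩) hE0
  simp

lemma SatisfiesNAK.subsingleton {R N : Type*} [CommRing R] [IsLocalRing R] [AddCommGroup N]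
    [Module R N] (h : SatisfiesNAK R N)
    (hN : IsLocalRing.maximalIdeal R • (⊤ : Submodule R N) = ⊤) : Subsingleton N := by
  refine h.resolve_right fun hnt ↦ ?_
  exact not_subsingleton _ (Submodule.Quotient.subsingleton_iff.mpr hN)

end Ext

theorem lemma3p1 {R S : Type u} [CommRing R] [IsLocalRing R] [IsNoetherianRing R]
    [CommRing S] [IsLocalRing S] [IsNoetherianRing S]
    [Algebra R S] [IsLocalHom (algebraMap R S)] [Module.Flat R S]
    (hiso : Function.Bijective (inducedResidueMap R S))
    (M : Type u) [AddCommGroup M] [Module R M] (z : ℕ) (hz : 1 ≤ z)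
    (hvanish : ∀ i : ℕ, z < i →
      Subsingleton (Abelian.Ext (ModuleCat.of R S) (ModuleCat.of R M) i))
    (hNAK : SatisfiesNAK R (Abelian.Ext (ModuleCat.of R S) (ModuleCat.of R M) z)) :
    Subsingleton (Abelian.Ext (ModuleCat.of R S) (ModuleCat.of R M) z) := by
  have : Module.FaithfullyFlat R S := Module.FaithfullyFlat.of_flat_of_isLocalHom
  set 𝔪 := IsLocalRing.maximalIdeal R
  let C := S ⧸ LinearMap.range (Algebra.linearMap R S)
  let q : S →ₗ[R] C := (LinearMap.range (Algebra.linearMap R S)).mkQ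
  have : Module.Flat R C := flat_quotient_range_of_faithfullyFlat S
  -- Surjectivity of `R / 𝔪 → S / 𝔪 S` says `S = R + 𝔪 S`.
  have hC : 𝔪 • (⊤ : Submodule R C) = ⊤ := by
    refine eq_top_iff.mpr fun c _ ↦ ?_
    obtain ⟨s, rfl⟩ := Submodule.mkQ_surjective _ c
    obtain ⟨r, hr⟩ := hiso.2 (Ideal.Quotient.mk _ s)
    obtain ⟨r, rfl⟩ := Ideal.Quotient.mk_surjective r
    rw [inducedResidueMap, Ideal.quotientMap_mk, eq_comm, Ideal.Quotient.eq] at hr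
    have hmem : s - algebraMap R S r ∈ 𝔪 • (⊤ : Submodule R S) := by
      rw [Ideal.smul_top_eq_map]
      exact hr
    have h := Submodule.mem_map_of_mem (f := q) hmem
    rw [Submodule.map_smul'', map_sub, show q (algebraMap R S r) = 0 from
      (Submodule.Quotient.mk_eq_zero _).mpr ⟨r, rfl⟩, sub_zero] at h
    exact (smul_mono_right 𝔪 le_top : _ ≤ 𝔪 • (⊤ : Submodule R C)) h
  have hS : (ShortComplex.mk (ModuleCat.ofHom (Algebra.linearMap R S)) (ModuleCat.ofHom q)
      (ModuleCat.hom_ext (LinearMap.range_mkQ_comp _))).ShortExact :=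
    ModuleCat.shortComplex_shortExact _ (LinearMap.exact_map_mkQ_range _)
      (FaithfulSMul.algebraMap_injective R S) (Submodule.mkQ_surjective _)
  have hR (k : ℕ) (hk : 1 ≤ k) :
      Subsingleton (Abelian.Ext (ModuleCat.of R R) (ModuleCat.of R M) k) := by
    obtain ⟨k, rfl⟩ := Nat.exists_eq_add_of_le' hk
    exact Abelian.Ext.subsingleton_of_projective _ _ k
  have hCvanish (k : ℕ) (hk : z < k) :
      Subsingleton (Abelian.Ext (ModuleCat.of R C) (ModuleCat.of R M) k) := by
    obtain ⟨k, rfl⟩ := Nat.exists_eq_add_of_lt hk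
    refine subsingleton_of_forall_eq 0 fun α ↦ ?_
    have := hvanish _ hk
    have := hR (z + k) (by lia)
    obtain ⟨β, rfl⟩ := Abelian.Ext.contravariant_sequence_exact₃ hS _ α
      (Subsingleton.elim (α := Abelian.Ext (ModuleCat.of R S) (ModuleCat.of R M) _) _ _)
      (add_comm 1 (z + k))
    rw [Subsingleton.elim (α := Abelian.Ext (ModuleCat.of R R) (ModuleCat.of R M) _) β 0,
      Abelian.Ext.comp_zero]
  have hsurj : Function.Surjective
      ((Abelian.Ext.mk₀ (ModuleCat.ofHom q)).precomp (ModuleCat.of R M) (zero_add z)) := fun α ↦ by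
    have := hR z hz
    exact Abelian.Ext.contravariant_sequence_exact₂ hS _ α
      (Subsingleton.elim (α := Abelian.Ext (ModuleCat.of R R) (ModuleCat.of R M) _) _ _)
  exact hNAK.subsingleton (smul_top_ext_eq_top_of_precomp_surjective _ hsurj
    (smul_top_ext_eq_top_of_flat C (IsNoetherian.noetherian 𝔪) hC hCvanish))
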